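/- Let $P$ be a finite path with vertex set $V$, and let the vertices of $P$ be coloured arbitrarily (adjacent vertices may have the same colour). For each colour $k$ that occurs, let $U_k\subseteq V$ be the set of vertices of colour $k$. Then there are a set $D\subseteq V$ containing exactly one vertex from each colour class $U_k$, and a partition of $V\setminus D$ into two disjoint (possibly empty) sets $A$ and $B$, both independent in $P$, such that $-1\le |A\cap U|-|B\cap U|\le 1$ for every colour class $U$. -/

import Mathlib

/-! Encode a candidate as a sign vector along the path: the two signs mark A and B, `none` marks D.
With n vertices and m colours, it suffices to find a vector that exhausts no colour and has an
alternating subsequence of length at least n - m. Each colour then keeps an unsigned vertex, so at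
most n - m vertices are signed; equality must hold throughout, so each colour has exactly one
unsigned vertex and the signs alternate (`exists_fair_signs`).

If there were no such vector, alternation lengths (no colour exhausted) and exhausted colours
(otherwise) would label the nonzero vectors antipodally with n - 1 absolute values and no
complementary comparable pair, contradicting the octahedral Tucker lemma (`IsTuckerLabelling.le`).
That lemma follows from a parity count of flags with alternating labels (`sum_flag_eq_one`), whose
local step is `sum_altWeight_erase`. -/

/-! ### Alternating multisets of labels, modulo 2 -/

/-- A multiset of labels `(|a|, sign a)` with all `|a| < m` is weighted `1` if its members have
distinct absolute values and, read from the largest one down, alternate in sign starting with `b`;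
otherwise it is weighted `0`. -/
def altWeight : ℕ → Bool → Multiset (ℕ × Bool) → ZMod 2
  | 0, _, M => if M = 0 then 1 else 0
  | m + 1, b, M =>
    if M.filter (fun a => a.1 = m) = 0 then altWeight m b (M.filter (fun a => ¬ a.1 = m))
    else if M.filter (fun a => a.1 = m) = {(m, b)} then
      altWeight m (!b) (M.filter (fun a => ¬ a.1 = m))
    else 0

theorem altWeight_zero (m : ℕ) (b : Bool) : altWeight m b 0 = 1 := by
  induction m generalizing b with
  | zero => simp [altWeight]
  | succ m ih => simp [altWeight, ih]

theorem card_le_of_altWeight_ne_zero {m : ℕ} {b : Bool} {M : Multiset (ℕ × Bool)}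
    (h : altWeight m b M ≠ 0) : M.card ≤ m := by
  induction m generalizing b M with
  | zero =>
    by_cases hM : M = 0
    · simp [hM]
    · simp [altWeight, hM] at h
  | succ m ih =>
    have hc : M.card = (M.filter (fun a => a.1 = m)).card
        + (M.filter (fun a => ¬ a.1 = m)).card := by
      rw [← Multiset.card_add, Multiset.filter_add_not]
    rw [altWeight] at h
    split_ifs at h with h1 h2
    · have := ih h
      rw [h1] at hc
      simp only [Multiset.card_zero] at hc
      omega
    · have := ih h
      rw [h2] at hc
      simp only [Multiset.card_singleton] at hc
      omega
    · exact absurd rfl h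

theorem altWeight_succ_add {m : ℕ} (b : Bool) {F R : Multiset (ℕ × Bool)}
    (hF : ∀ a ∈ F, a.1 = m) (hR : ∀ a ∈ R, ¬ a.1 = m) :
    altWeight (m + 1) b (F + R) =
      if F = 0 then altWeight m b R else if F = {(m, b)} then altWeight m (!b) R else 0 := by
  have h1 : (F + R).filter (fun a => a.1 = m) = F := by
    rw [Multiset.filter_add, Multiset.filter_eq_self.2 hF, Multiset.filter_eq_nil.2 hR, add_zero]
  have h2 : (F + R).filter (fun a => ¬ a.1 = m) = R := by
    rw [Multiset.filter_add, Multiset.filter_eq_self.2 hR,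
      Multiset.filter_eq_nil.2 (fun a ha => not_not.2 (hF a ha)), zero_add]
  rw [altWeight, h1, h2]

theorem altWeight_map_not (m : ℕ) (b : Bool) (M : Multiset (ℕ × Bool)) :
    altWeight m b (M.map fun a => (a.1, !a.2)) = altWeight m (!b) M := by
  induction m generalizing b M with
  | zero => simp [altWeight]
  | succ m ih =>
    have h2 : (M.filter fun a => a.1 = m).map (fun a => (a.1, !a.2)) = {(m, b)} ↔
        (M.filter fun a => a.1 = m) = {(m, !b)} := by
      rw [Multiset.map_eq_singleton]
      constructor
      · rintro ⟨⟨a, s⟩, ha, h⟩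
        simp only [Prod.mk.injEq] at h
        rw [ha, ← h.1, ← h.2, Bool.not_not]
      · intro h
        exact ⟨_, h, by simp⟩
    simp only [altWeight, Multiset.filter_map, Function.comp_def, Multiset.map_eq_zero, ih, h2]

/-- An alternating multiset stays alternating only when its largest or smallest member is erased,
and just one of these leaves the leading sign `b`. A multiset that does not alternate can be
repaired by an erasure in either no way or two ways, which cancel. -/
theorem sum_altWeight_erase {m : ℕ} (b : Bool) {M : Multiset (ℕ × Bool)}
    (hlt : ∀ a ∈ M, a.1 < m) (hcompl : ∀ a ∈ M, (a.1, !a.2) ∉ M) :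
    (M.map fun a => altWeight m b (M.erase a)).sum = altWeight m b M + altWeight m (!b) M := by
  induction m generalizing b M with
  | zero =>
    have : M = 0 := Multiset.eq_zero_of_forall_notMem fun a ha => by simpa using hlt a ha
    subst this
    cases b <;> simp [altWeight] <;> decide
  | succ m ih =>
    obtain ⟨F, R, rfl, hF, hR⟩ : ∃ F R, M = F + R ∧ (∀ a ∈ F, a.1 = m) ∧ ∀ a ∈ R, ¬ a.1 = m :=
      ⟨M.filter (fun a => a.1 = m), M.filter (fun a => ¬ a.1 = m),
        (Multiset.filter_add_not _ _).symm, fun a ha => (Multiset.mem_filter.1 ha).2,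
        fun a ha => (Multiset.mem_filter.1 ha).2⟩
    have ihR := fun b => ih b (M := R)
      (fun a ha => by
        have := hlt a (Multiset.mem_add.2 (Or.inr ha))
        have := hR a ha
        omega)
      (fun a ha h => hcompl a (Multiset.mem_add.2 (Or.inr ha)) (Multiset.mem_add.2 (Or.inr h)))
    have hRsum : (R.map fun a => altWeight (m + 1) b ((F + R).erase a)).sum =
        (R.map fun a => if F = 0 then altWeight m b (R.erase a) else
          if F = {(m, b)} then altWeight m (!b) (R.erase a) else 0).sum := by
      congr 1
      refine Multiset.map_congr rfl fun a ha => ?_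
      rw [Multiset.erase_add_right_pos _ ha]
      exact altWeight_succ_add b hF fun a' ha' => hR a' (Multiset.mem_of_mem_erase ha')
    have hFsum : (F.map fun a => altWeight (m + 1) b ((F + R).erase a)).sum =
        (F.map fun a => if F.erase a = 0 then altWeight m b R else
          if F.erase a = {(m, b)} then altWeight m (!b) R else 0).sum := by
      congr 1
      refine Multiset.map_congr rfl fun a ha => ?_
      rw [Multiset.erase_add_left_pos _ ha]
      exact altWeight_succ_add b (fun a' ha' => hF a' (Multiset.mem_of_mem_erase ha')) hR
    rw [Multiset.map_add, Multiset.sum_add, hFsum, hRsum, altWeight_succ_add b hF hR,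
      altWeight_succ_add (!b) hF hR]
    obtain rfl | ⟨⟨m', c⟩, hc⟩ := F.empty_or_exists_mem
    · simp [ihR]
    obtain rfl : m' = m := hF _ hc
    -- Since complementary labels are excluded, all members of top absolute value coincide.
    have hrep : F = Multiset.replicate F.card (m', c) := by
      refine Multiset.eq_replicate.2 ⟨rfl, fun a ha => ?_⟩
      obtain ⟨a1, a2⟩ := a
      obtain rfl : a1 = m' := hF _ ha
      have := hcompl _ (Multiset.mem_add.2 (Or.inl hc))
      by_cases h : a2 = c
      · rw [h]
      · refine absurd (Multiset.mem_add.2 (Or.inl ha) : _ ∈ F + R) ?_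
        rwa [show a2 = !c by cases a2 <;> cases c <;> simp_all]
    obtain ⟨t, ht⟩ : ∃ t, F.card = t + 1 :=
      Nat.exists_eq_succ_of_ne_zero fun h => by rw [Multiset.card_eq_zero.1 h] at hc; simp at hc
    have hne : ∀ (a a' d : ℕ × Bool) (N : Multiset (ℕ × Bool)), a ::ₘ a' ::ₘ N ≠ {d} :=
      fun a a' d N h => by simpa using congrArg Multiset.card h
    have hne' : ∀ a a' d : ℕ × Bool, a ::ₘ {a'} ≠ ({d} : Multiset (ℕ × Bool)) :=
      fun a a' d => hne a a' d 0
    rw [ht] at hrep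
    subst hrep
    -- Multiplicity one uses the induction hypothesis; multiplicity two gives two equal terms, which
    -- cancel; from three on every term vanishes.
    obtain _ | _ | t := t
    · have key : ∀ u v : ZMod 2, u + (v + u) = v := by decide
      cases b <;> cases c <;> simp [ihR, key]
    · have key : ∀ u : ZMod 2, u + u = 0 := by decide
      cases b <;> cases c <;> simp [Multiset.replicate_succ, key, hne']
    · simp [Multiset.replicate_succ, hne]

/-! ### Maximal flags of sign vectors and their facets -/

/-- A flag of the cross-polytope: for a permutation `σ` and signs `ε`, the `i`-th sign vector has
the coordinates `σ p`, `i ≤ p`, set to their signs. -/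
def flagVec {k : ℕ} (σ : Equiv.Perm (Fin k)) (ε : Fin k → Bool) (i : Fin k) :
    Fin k → Option Bool :=
  fun j => if i ≤ σ.symm j then some (ε j) else none

theorem flagVec_ne_none {k : ℕ} (σ : Equiv.Perm (Fin k)) (ε : Fin k → Bool) (i : Fin k) :
    flagVec σ ε i ≠ fun _ => none := fun h => by
  simpa [flagVec] using congrFun h (σ i)

theorem flagVec_not {k : ℕ} (σ : Equiv.Perm (Fin k)) (ε : Fin k → Bool) (i : Fin k) :
    flagVec σ (fun j => !ε j) i = fun j => (flagVec σ ε i j).map (!·) := by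
  funext j
  simp only [flagVec]
  split_ifs <;> rfl

theorem flagVec_mono {k : ℕ} (σ : Equiv.Perm (Fin k)) (ε : Fin k → Bool) {i i' : Fin k}
    (h : i' ≤ i) (j : Fin k) (s : Bool) (hs : flagVec σ ε i j = some s) :
    flagVec σ ε i' j = some s := by
  simp only [flagVec] at hs ⊢
  split_ifs at hs with h1
  rw [if_pos (h.trans h1), hs]

theorem flagVec_mul_swap {k : ℕ} (σ : Equiv.Perm (Fin (k + 1))) (ε : Fin (k + 1) → Bool)
    (i : Fin k) {l : Fin (k + 1)} (hl : l ≠ i.succ) :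
    flagVec (σ * Equiv.swap i.castSucc i.succ) ε l = flagVec σ ε l := by
  funext j
  have : l ≤ Equiv.swap i.castSucc i.succ (σ.symm j) ↔ l ≤ σ.symm j := by
    rw [Equiv.swap_apply_def]
    simp only [Fin.le_def, Fin.ext_iff, Fin.val_succ, Fin.val_castSucc, ne_eq] at hl ⊢
    split_ifs with h1 h2 <;> simp only [Fin.val_succ, Fin.val_castSucc] <;> omega
  have h' : (σ * Equiv.swap i.castSucc i.succ).symm j =
      Equiv.swap i.castSucc i.succ (σ.symm j) := rfl
  simp only [flagVec, h', this]

theorem flagVec_update {k : ℕ} (σ : Equiv.Perm (Fin (k + 1))) (ε : Fin (k + 1) → Bool) (s : Bool)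
    {l : Fin (k + 1)} (hl : l ≠ 0) :
    flagVec σ (Function.update ε (σ 0) s) l = flagVec σ ε l := by
  funext j
  simp only [flagVec]
  by_cases h : j = σ 0
  · subst h
    simp [hl]
  · rw [Function.update_of_ne h]

theorem flagVec_decomposeFin {k : ℕ} (e : Equiv.Perm (Fin k)) (ε : Fin k → Bool) (s : Bool)
    (i : Fin k) :
    flagVec (Equiv.Perm.decomposeFin.symm (0, e)) (Fin.cons s ε : Fin (k + 1) → Bool) i.succ =
      (Fin.cons none (flagVec e ε i) : Fin (k + 1) → Option Bool) := by
  funext j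
  refine Fin.cases ?_ (fun j => ?_) j
  · have : (Equiv.Perm.decomposeFin.symm ((0 : Fin (k + 1)), e)).symm 0 = 0 := by
      rw [Equiv.symm_apply_eq]; simp
    simp [flagVec, this]
  · have : (Equiv.Perm.decomposeFin.symm ((0 : Fin (k + 1)), e)).symm j.succ =
        (e.symm j).succ := by
      rw [Equiv.symm_apply_eq]; simp
    simp [flagVec, this]

/-- The labels of the members of a flag, that in position `i` omitted. -/
def facetLabels {k : ℕ} (lam : (Fin k → Option Bool) → ℕ × Bool) (σ : Equiv.Perm (Fin k))
    (ε : Fin k → Bool) (i : Fin k) : Multiset (ℕ × Bool) :=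
  (Finset.univ.erase i).val.map fun l => lam (flagVec σ ε l)

/-- The labels of the members of a flag. -/
def flagLabels {k : ℕ} (lam : (Fin k → Option Bool) → ℕ × Bool) (σ : Equiv.Perm (Fin k))
    (ε : Fin k → Bool) : Multiset (ℕ × Bool) :=
  Finset.univ.val.map fun l => lam (flagVec σ ε l)

theorem flagLabels_erase {k : ℕ} (lam : (Fin k → Option Bool) → ℕ × Bool)
    (σ : Equiv.Perm (Fin k)) (ε : Fin k → Bool) (i : Fin k) :
    (flagLabels lam σ ε).erase (lam (flagVec σ ε i)) = facetLabels lam σ ε i := by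
  have : (Finset.univ : Finset (Fin k)).val = i ::ₘ (Finset.univ.erase i).val := by
    rw [Finset.erase_val, Multiset.cons_erase (Finset.mem_univ i)]
  rw [flagLabels, this, Multiset.map_cons, Multiset.erase_cons_head, facetLabels]

theorem facetLabels_congr {k : ℕ} (lam : (Fin k → Option Bool) → ℕ × Bool)
    {σ σ' : Equiv.Perm (Fin k)} {ε ε' : Fin k → Bool} {i : Fin k}
    (h : ∀ l, l ≠ i → flagVec σ ε l = flagVec σ' ε' l) :
    facetLabels lam σ ε i = facetLabels lam σ' ε' i :=
  Multiset.map_congr rfl fun l hl => by rw [h l (Finset.ne_of_mem_erase (show l ∈ Finset.univ.erase i from hl))]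

/-! ### The octahedral Tucker lemma -/

/-- The hypotheses of the octahedral Tucker lemma, with labels below `m`. -/
structure IsTuckerLabelling {k : ℕ} (m : ℕ) (lam : (Fin k → Option Bool) → ℕ × Bool) : Prop where
  lt : ∀ x, x ≠ (fun _ => none) → (lam x).1 < m
  antipodal : ∀ x, x ≠ (fun _ => none) →
    lam (fun j => (x j).map (!·)) = ((lam x).1, !(lam x).2)
  compl : ∀ x y, x ≠ (fun _ => none) → (∀ j s, x j = some s → y j = some s) →
    lam y ≠ ((lam x).1, !(lam x).2)

namespace IsTuckerLabelling

variable {k m : ℕ}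

theorem flagLabels_not {lam : (Fin k → Option Bool) → ℕ × Bool} (h : IsTuckerLabelling m lam)
    (σ : Equiv.Perm (Fin k)) (ε : Fin k → Bool) :
    flagLabels lam σ (fun j => !ε j) = (flagLabels lam σ ε).map fun a => (a.1, !a.2) := by
  simp only [flagLabels, Multiset.map_map, Function.comp_def, flagVec_not,
    h.antipodal _ (flagVec_ne_none _ _ _)]

theorem sum_facetLabels {lam : (Fin k → Option Bool) → ℕ × Bool} (h : IsTuckerLabelling m lam)
    (b : Bool) (σ : Equiv.Perm (Fin k)) (ε : Fin k → Bool) :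
    ∑ i, altWeight m b (facetLabels lam σ ε i) =
      altWeight m b (flagLabels lam σ ε) + altWeight m (!b) (flagLabels lam σ ε) := by
  rw [← sum_altWeight_erase]
  · simp only [← flagLabels_erase]
    rw [flagLabels, Multiset.map_map]
    rfl
  · intro a ha
    obtain ⟨i, -, rfl⟩ := Multiset.mem_map.1 ha
    exact h.lt _ (flagVec_ne_none _ _ _)
  · intro a ha ha'
    obtain ⟨i, -, rfl⟩ := Multiset.mem_map.1 ha
    obtain ⟨i', -, hi'⟩ := Multiset.mem_map.1 ha'
    rcases le_total i' i with hle | hle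
    · exact h.compl _ _ (flagVec_ne_none σ ε i) (flagVec_mono σ ε hle) hi'
    · refine h.compl _ _ (flagVec_ne_none σ ε i') (flagVec_mono σ ε hle) ?_
      rw [hi']
      simp

theorem cons_none {lam : (Fin (k + 1) → Option Bool) → ℕ × Bool} (h : IsTuckerLabelling m lam) :
    IsTuckerLabelling m fun x : Fin k → Option Bool => lam (Fin.cons none x) := by
  have hne : ∀ x : Fin k → Option Bool, x ≠ (fun _ => none) →
      (Fin.cons none x : Fin (k + 1) → Option Bool) ≠ fun _ => none := fun x hx hc =>
    hx (funext fun j => by simpa using congrFun hc j.succ)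
  refine ⟨fun x hx => h.lt _ (hne x hx), fun x hx => ?_, fun x y hx hxy => ?_⟩
  · rw [← h.antipodal _ (hne x hx)]
    congr 1
    funext j
    refine Fin.cases ?_ (fun j => ?_) j <;> simp
  · refine h.compl _ _ (hne x hx) fun j => ?_
    refine Fin.cases ?_ (fun j => ?_) j
    · simp
    · simpa using hxy j

/-- Adding the weights of antipodal flags turns the sum into one over facets of the hemisphere where
coordinate 0 is positive. Interior facets cancel in pairs, and the boundary is the same problem one
dimension lower. -/
theorem sum_flag_eq_one (b : Bool) {lam : (Fin k → Option Bool) → ℕ × Bool}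
    (h : IsTuckerLabelling m lam) :
    ∑ σ : Equiv.Perm (Fin k), ∑ ε : Fin k → Bool, altWeight m b (flagLabels lam σ ε) = 1 := by
  have two : ∀ u : ZMod 2, u + u = 0 := by decide
  induction k with
  | zero =>
    simp [flagLabels, altWeight_zero]
  | succ k ih =>
    have split : ∀ σ : Equiv.Perm (Fin (k + 1)),
        ∑ ε : Fin (k + 1) → Bool, altWeight m b (flagLabels lam σ ε) =
        ∑ ε : Fin k → Bool,
          ∑ i, altWeight m b (facetLabels lam σ (Fin.cons true ε : Fin (k + 1) → Bool) i) := by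
      intro σ
      simp only [h.sum_facetLabels, Finset.sum_add_distrib]
      rw [← (Fin.consEquiv fun _ : Fin (k + 1) => Bool).sum_comp, Fintype.sum_prod_type,
        Fintype.sum_bool]
      congr 1
      refine Fintype.sum_equiv (Equiv.arrowCongr (Equiv.refl _) Equiv.boolNot) _ _ fun ε => ?_
      rw [← altWeight_map_not, ← h.flagLabels_not]
      congr 2
      funext j
      refine Fin.cases ?_ (fun j => ?_) j <;> simp [Fin.consEquiv]
    simp only [split]
    -- A facet missing a vector other than the full one lies in two flags, which differ by an
    -- adjacent transposition.
    have swap : ∀ i : Fin k, ∑ σ : Equiv.Perm (Fin (k + 1)), ∑ ε : Fin k → Bool,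
        altWeight m b (facetLabels lam σ (Fin.cons true ε : Fin (k + 1) → Bool) i.succ) = 0 := by
      intro i
      rw [Finset.sum_comm]
      refine Finset.sum_eq_zero fun ε _ => ?_
      refine Finset.sum_involution (fun σ _ => σ * Equiv.swap i.castSucc i.succ) ?_ ?_ ?_ ?_
      · intro σ _
        rw [facetLabels_congr lam fun l hl => flagVec_mul_swap σ _ i hl]
        exact two _
      · intro σ _ _ hσ
        rw [mul_eq_left, Equiv.swap_eq_one_iff] at hσ
        exact (Fin.castSucc_lt_succ (i := i)).ne hσ
      · intros
        exact Finset.mem_univ _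
      · intro σ _
        rw [mul_assoc, Equiv.swap_mul_self, mul_one]
    -- Without the full vector, the sign of coordinate `σ 0` is invisible; it may be flipped unless
    -- that coordinate is 0, whose sign is fixed.
    have flip : ∀ (σ : Equiv.Perm (Fin (k + 1))) (j : Fin k), σ 0 = j.succ → ∑ ε : Fin k → Bool,
        altWeight m b (facetLabels lam σ (Fin.cons true ε : Fin (k + 1) → Bool) 0) = 0 := by
      intro σ j hj
      refine Finset.sum_involution (fun ε _ => Function.update ε j (!ε j)) ?_ ?_ ?_ ?_
      · intro ε _
        rw [Fin.cons_update, ← hj, facetLabels_congr lam fun l hl => flagVec_update σ _ _ hl]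
        exact two _
      · intro ε _ _ hε
        simpa using congrFun hε j
      · intros
        exact Finset.mem_univ _
      · intro ε _
        simp
    calc ∑ σ : Equiv.Perm (Fin (k + 1)), ∑ ε : Fin k → Bool, ∑ i : Fin (k + 1),
          altWeight m b (facetLabels lam σ (Fin.cons true ε : Fin (k + 1) → Bool) i)
        = ∑ σ : Equiv.Perm (Fin (k + 1)), ∑ ε : Fin k → Bool,
          altWeight m b (facetLabels lam σ (Fin.cons true ε : Fin (k + 1) → Bool) 0) := by
          simp only [Fin.sum_univ_succ, Finset.sum_add_distrib]
          rw [add_eq_left]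
          rw [Finset.sum_congr rfl fun σ _ => Finset.sum_comm, Finset.sum_comm]
          exact Finset.sum_eq_zero fun i _ => swap i
      _ = ∑ e : Equiv.Perm (Fin k), ∑ ε : Fin k → Bool,
          altWeight m b (facetLabels lam (Equiv.Perm.decomposeFin.symm (0, e))
            (Fin.cons true ε : Fin (k + 1) → Bool) 0) := by
          rw [← Equiv.Perm.decomposeFin.symm.sum_comp, Fintype.sum_prod_type, Fin.sum_univ_succ,
            add_eq_left]
          exact Finset.sum_eq_zero fun j _ => Finset.sum_eq_zero fun e _ => flip _ j (by simp)
      _ = 1 := by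
          rw [← ih h.cons_none]
          refine Finset.sum_congr rfl fun e _ => Finset.sum_congr rfl fun ε _ => ?_
          congr 1
          have : (Finset.univ.erase (0 : Fin (k + 1))).val =
              (Finset.univ : Finset (Fin k)).val.map Fin.succ := by
            rw [show Finset.univ.erase (0 : Fin (k + 1)) = Finset.univ.map (Fin.succEmb k) by
              ext j; refine Fin.cases ?_ (fun j => ?_) j <;> simp]
            rfl
          rw [facetLabels, this, Multiset.map_map, flagLabels]
          simp only [Function.comp_def, flagVec_decomposeFin]

/-- The octahedral Tucker lemma. -/
theorem le {lam : (Fin k → Option Bool) → ℕ × Bool} (h : IsTuckerLabelling m lam) : k ≤ m := by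
  have h1 := h.sum_flag_eq_one true
  obtain ⟨σ, -, hσ⟩ := Finset.exists_ne_zero_of_sum_ne_zero (h1.trans_ne one_ne_zero)
  obtain ⟨ε, -, hε⟩ := Finset.exists_ne_zero_of_sum_ne_zero hσ
  simpa [flagLabels] using card_le_of_altWeight_ne_zero hε

end IsTuckerLabelling

/-! ### Alternation of sign vectors -/

/-- The length of a longest alternating sequence of signs read off from `x` that starts
with `!b`. -/
def altLen : ∀ {n : ℕ}, (Fin n → Option Bool) → Bool → ℕ
  | 0, _, _ => 0
  | _ + 1, x, b =>
    match x 0 with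
    | none => altLen (fun j => x j.succ) b
    | some s => if s = b then altLen (fun j => x j.succ) b else altLen (fun j => x j.succ) s + 1

/-- The first sign occurring in `x`. -/
def firstSign : ∀ {n : ℕ}, (Fin n → Option Bool) → Bool
  | 0, _ => true
  | _ + 1, x => (x 0).getD (firstSign fun j => x j.succ)

section altLen

variable {n : ℕ}

theorem altLen_of_none {x : Fin (n + 1) → Option Bool} (h : x 0 = none) (b : Bool) :
    altLen x b = altLen (fun j => x j.succ) b := by
  rw [altLen, h]

theorem altLen_of_same {x : Fin (n + 1) → Option Bool} {b : Bool} (h : x 0 = some b) :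
    altLen x b = altLen (fun j => x j.succ) b := by
  rw [altLen, h]
  simp

theorem altLen_of_not {x : Fin (n + 1) → Option Bool} {b : Bool} (h : x 0 = some (!b)) :
    altLen x b = altLen (fun j => x j.succ) (!b) + 1 := by
  rw [altLen, h]
  simp

theorem eq_none_or_eq_some_or_eq_some_not (b : Bool) (o : Option Bool) :
    o = none ∨ o = some b ∨ o = some (!b) := by
  revert b o
  decide

theorem altLen_le_add_one (x : Fin n → Option Bool) (b : Bool) :
    altLen x b ≤ altLen x (!b) + 1 := by
  induction n generalizing b with
  | zero => simp [altLen]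
  | succ n ih =>
    rcases eq_none_or_eq_some_or_eq_some_not b (x 0) with h | h | h
    · rw [altLen_of_none h, altLen_of_none h]
      exact ih _ _
    · rw [altLen_of_same h, altLen_of_not (b := !b) (by rw [h, Bool.not_not]), Bool.not_not]
      omega
    · rw [altLen_of_not h, altLen_of_same h]

theorem altLen_mono {x y : Fin n → Option Bool} (h : ∀ j s, x j = some s → y j = some s)
    (b : Bool) : altLen x b ≤ altLen y b := by
  induction n generalizing b with
  | zero => simp [altLen]
  | succ n ih =>
    have ih' := ih (x := fun j => x j.succ) (y := fun j => y j.succ) fun j => h j.succ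
    rcases eq_none_or_eq_some_or_eq_some_not b (x 0) with hx | hx | hx
    · rw [altLen_of_none hx]
      rcases eq_none_or_eq_some_or_eq_some_not b (y 0) with hy | hy | hy
      · rw [altLen_of_none hy]
        exact ih' b
      · rw [altLen_of_same hy]
        exact ih' b
      · rw [altLen_of_not hy]
        exact (ih' b).trans (altLen_le_add_one _ _)
    · rw [altLen_of_same hx, altLen_of_same (h _ _ hx)]
      exact ih' b
    · rw [altLen_of_not hx, altLen_of_not (h _ _ hx)]
      exact Nat.succ_le_succ (ih' _)

theorem altLen_map_not (x : Fin n → Option Bool) (b : Bool) :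
    altLen (fun j => (x j).map (!·)) b = altLen x (!b) := by
  induction n generalizing b with
  | zero => simp [altLen]
  | succ n ih =>
    rcases eq_none_or_eq_some_or_eq_some_not b (x 0) with h | h | h
    · rw [altLen_of_none h, altLen_of_none (by simp [h]), ih]
    · rw [altLen_of_not (b := !b) (by simp [h]), altLen_of_not (by simp [h]), ih]
    · rw [altLen_of_same h, altLen_of_same (by simp [h]), ih]

theorem firstSign_map_not {x : Fin n → Option Bool} (hx : x ≠ fun _ => none) :
    firstSign (fun j => (x j).map (!·)) = !firstSign x := by
  induction n with
  | zero => exact absurd (Subsingleton.elim _ _) hx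
  | succ n ih =>
    rcases h : x 0 with _ | s
    · have : (fun j : Fin n => x j.succ) ≠ fun _ => none := fun hc => hx <| funext fun j =>
        Fin.cases h (fun j => congrFun hc j) j
      simp [firstSign, h, ih this]
    · simp [firstSign, h]

theorem altLen_not_firstSign {x : Fin n → Option Bool} (hx : x ≠ fun _ => none) :
    altLen x (!firstSign x) = altLen x (firstSign x) + 1 := by
  induction n with
  | zero => exact absurd (Subsingleton.elim _ _) hx
  | succ n ih =>
    rcases h : x 0 with _ | s
    · have : (fun j : Fin n => x j.succ) ≠ fun _ => none := fun hc => hx <| funext fun j =>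
        Fin.cases h (fun j => congrFun hc j) j
      rw [altLen_of_none h, altLen_of_none h, firstSign, h]
      exact ih this
    · have : firstSign x = s := by simp [firstSign, h]
      rw [this, altLen_of_same h, altLen_of_not (b := !s) (by rw [h, Bool.not_not]), Bool.not_not]

theorem altLen_le_sum (x : Fin n → Option Bool) (b : Bool) :
    altLen x b ≤ ∑ i, if x i = none then 0 else 1 := by
  induction n generalizing b with
  | zero => simp [altLen]
  | succ n ih =>
    have ih' := ih fun j => x j.succ
    rw [Fin.sum_univ_succ]
    rcases eq_none_or_eq_some_or_eq_some_not b (x 0) with h | h | h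
    · rw [altLen_of_none h]
      simpa [h] using ih' b
    · rw [altLen_of_same h]
      exact (ih' b).trans (Nat.le_add_left _ _)
    · rw [altLen_of_not h, h, if_neg (by simp), add_comm]
      exact Nat.add_le_add_left (ih' _) 1

/-- An alternating subsequence cannot use both of two neighbouring equal signs. -/
theorem altLen_lt_sum {x : Fin n → Option Bool} {i j : Fin n} {s : Bool}
    (hij : (i : ℕ) + 1 = j) (hi : x i = some s) (hj : x j = some s) (b : Bool) :
    altLen x b < ∑ i, if x i = none then 0 else 1 := by
  induction n generalizing b with
  | zero => exact i.elim0
  | succ n ih =>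
    have hle := altLen_le_sum fun j => x j.succ
    obtain ⟨j, rfl⟩ := Fin.exists_succ_eq.2 (show j ≠ 0 by rintro rfl; simp at hij)
    rw [Fin.sum_univ_succ]
    obtain rfl | ⟨i, rfl⟩ := i.eq_zero_or_eq_succ
    · obtain _ | n := n
      · exact j.elim0
      obtain rfl : j = 0 := Fin.ext (by simpa using hij.symm)
      have key : altLen x b ≤ altLen (fun j => x j.succ) s + 1 := by
        rcases eq_none_or_eq_some_or_eq_some_not b (x 0) with h | h | h
        · simp [h] at hi
        · obtain rfl : b = s := by simpa [h] using hi
          rw [altLen_of_same h]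
          omega
        · obtain rfl : (!b) = s := by simpa [h] using hi
          rw [altLen_of_not h]
      have h1 := altLen_le_sum (fun j : Fin n => x j.succ.succ) s
      rw [altLen_of_same (x := fun j => x j.succ) hj] at key
      rw [Fin.sum_univ_succ, hi, hj, if_neg (by simp)]
      omega
    · have ih' := ih (x := fun j => x j.succ) (i := i) (j := j)
        (by simpa using hij) hi hj
      rcases eq_none_or_eq_some_or_eq_some_not b (x 0) with h | h | h
      · rw [altLen_of_none h]
        simpa [h] using ih' b
      · rw [altLen_of_same h]
        exact (ih' b).trans_le (Nat.le_add_left _ _)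
      · rw [altLen_of_not h, h, if_neg (by simp), add_comm]
        exact Nat.add_lt_add_left (ih' _) 1

end altLen

/-! ### Colour counts and the Tucker labelling -/

section colouring

variable {n m : ℕ} (c : Fin n → Fin m)

/-- The number of entries `o` of `x` at the positions of colour `k`. -/
def entryCount (x : Fin n → Option Bool) (k : Fin m) (o : Option Bool) : ℕ :=
  (Finset.univ.filter fun i => c i = k ∧ x i = o).card

/-- Colour `k` is exhausted by `x`: a sign takes more than half of it, or it is all signed. -/
def IsExhausted (x : Fin n → Option Bool) (k : Fin m) : Prop :=
  entryCount c x k (some false) + entryCount c x k none < entryCount c x k (some true) ∨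
  entryCount c x k (some true) + entryCount c x k none < entryCount c x k (some false) ∨
  entryCount c x k none = 0

theorem entryCount_add (x : Fin n → Option Bool) (k : Fin m) :
    entryCount c x k (some true) + entryCount c x k (some false) + entryCount c x k none =
      (Finset.univ.filter fun i => c i = k).card := by
  have h := Finset.card_eq_sum_card_fiberwise (f := x)
    (s := Finset.univ.filter fun i => c i = k) (t := Finset.univ) (fun _ _ => by simp)
  rw [h, show (Finset.univ : Finset (Option Bool)) = {some true, some false, none} by decide]
  rw [Finset.sum_insert (by decide), Finset.sum_insert (by decide), Finset.sum_singleton]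
  simp only [entryCount, Finset.filter_filter, add_assoc]

theorem entryCount_map_not (x : Fin n → Option Bool) (k : Fin m) (o : Option Bool) :
    entryCount c (fun j => (x j).map (!·)) k o = entryCount c x k (o.map (!·)) := by
  have : ∀ u o : Option Bool, u.map (!·) = o ↔ u = o.map (!·) := by decide
  simp only [entryCount, this]

theorem isExhausted_map_not (x : Fin n → Option Bool) (k : Fin m) :
    IsExhausted c (fun j => (x j).map (!·)) k ↔ IsExhausted c x k := by
  simp only [IsExhausted, entryCount_map_not, Option.map_some, Option.map_none, Bool.not_true,
    Bool.not_false]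
  tauto

theorem entryCount_mono {x y : Fin n → Option Bool} (h : ∀ j s, x j = some s → y j = some s)
    (k : Fin m) (s : Bool) : entryCount c x k (some s) ≤ entryCount c y k (some s) :=
  Finset.card_le_card fun i hi => by
    simp only [Finset.mem_filter, Finset.mem_univ, true_and] at hi ⊢
    exact ⟨hi.1, h _ _ hi.2⟩

/-- The predominant sign of an exhausted colour, ties being resolved by the position `r`. -/
def majoritySign (x : Fin n → Option Bool) (k : Fin m) (r : Fin n) : Bool :=
  if entryCount c x k (some false) + entryCount c x k none < entryCount c x k (some true) then true
  else if entryCount c x k (some true) + entryCount c x k none < entryCount c x k (some false) then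
    false
  else (x r).getD true

variable {c}

theorem isSome_of_entryCount_none {x : Fin n → Option Bool} {k : Fin m} {r : Fin n}
    (hr : c r = k) (h : entryCount c x k none = 0) : ∃ s, x r = some s := by
  rw [← Option.ne_none_iff_exists']
  intro hx
  rw [entryCount, Finset.card_eq_zero] at h
  have : r ∈ (Finset.univ.filter fun i => c i = k ∧ x i = none) := by simp [hr, hx]
  simp [h] at this

theorem majoritySign_map_not {x : Fin n → Option Bool} {k : Fin m} {r : Fin n}
    (hr : c r = k) (h : IsExhausted c x k) :
    majoritySign c (fun j => (x j).map (!·)) k r = !majoritySign c x k r := by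
  simp only [majoritySign, entryCount_map_not, Option.map_some, Option.map_none, Bool.not_true,
    Bool.not_false]
  split_ifs with h1 h2 h2
  · omega
  · rfl
  · rfl
  · rcases h with h | h | h
    · exact absurd h h2
    · exact absurd h h1
    · obtain ⟨s, hs⟩ := isSome_of_entryCount_none hr h
      simp [hs]

/-- A strict majority of the whole class survives extension, and a fully signed class does not
change at all. -/
theorem majoritySign_eq {x y : Fin n → Option Bool} {k : Fin m} {r : Fin n}
    (hr : c r = k) (h : IsExhausted c x k) (hxy : ∀ j s, x j = some s → y j = some s) :
    majoritySign c y k r = majoritySign c x k r := by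
  have hx := entryCount_add c x k
  have hy := entryCount_add c y k
  have ht := entryCount_mono c hxy k true
  have hf := entryCount_mono c hxy k false
  have h' := h
  rw [IsExhausted] at h'
  simp only [majoritySign]
  split_ifs <;> first | rfl | omega | skip
  obtain ⟨s, hs⟩ := isSome_of_entryCount_none hr (show entryCount c x k none = 0 from
    (h.resolve_left ‹_›).resolve_left ‹_›)
  rw [hs, hxy _ _ hs]

theorem exists_alternating_fair (hc : Function.Surjective c) :
    ∃ x : Fin n → Option Bool, (∀ k, ¬ IsExhausted c x k) ∧
      n ≤ m + altLen x (!firstSign x) := by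
  classical
  by_contra! hbad
  -- The zero vector exhausts no colour, since every class is nonempty.
  have hzero : m < n := by
    have h := hbad (fun _ => none) fun k => by
      obtain ⟨r, rfl⟩ := hc k
      simp [IsExhausted, entryCount]
    omega
  choose r hr using hc
  -- Alternation lengths, shifted to start at 0, stay below n - m - 1; the m colours take the next m
  -- values, ending at n - 2.
  let lam : (Fin n → Option Bool) → ℕ × Bool := fun x =>
    if h : ∃ k, IsExhausted c x k then
      (n - m - 1 + h.choose, majoritySign c x h.choose (r h.choose))
    else (altLen x (!firstSign x) - 1, firstSign x)
  have lam_pos : ∀ x, (∃ k, IsExhausted c x k) → ∃ k, IsExhausted c x k ∧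
      lam x = (n - m - 1 + k, majoritySign c x k (r k)) := fun x h =>
    ⟨h.choose, h.choose_spec, dif_pos h⟩
  have lam_neg : ∀ x, (¬ ∃ k, IsExhausted c x k) →
      lam x = (altLen x (!firstSign x) - 1, firstSign x) := fun x h => dif_neg h
  have hlt : ∀ x, x ≠ (fun _ => none) → (¬ ∃ k, IsExhausted c x k) →
      altLen x (!firstSign x) - 1 < n - m - 1 := by
    intro x hx h
    have := hbad x (not_exists.1 h)
    have := altLen_not_firstSign hx
    omega
  have : IsTuckerLabelling (n - 1) lam := by
    refine ⟨fun x hx => ?_, fun x hx => ?_, fun x y hx hxy => ?_⟩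
    · by_cases h : ∃ k, IsExhausted c x k
      · obtain ⟨k, -, hk⟩ := lam_pos x h
        rw [hk]
        have := k.2
        dsimp only
        omega
      · rw [lam_neg x h]
        exact (hlt x hx h).trans_le (by omega)
    · have hiff : IsExhausted c (fun j => (x j).map (!·)) = IsExhausted c x :=
        funext fun k => propext (isExhausted_map_not c x k)
      by_cases h : ∃ k, IsExhausted c x k
      · simp only [lam, hiff]
        rw [dif_pos h, dif_pos h, majoritySign_map_not (hr _) h.choose_spec]
      · rw [lam_neg x h, lam_neg _ (by rwa [hiff]), altLen_map_not, firstSign_map_not hx,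
          Bool.not_not]
    · have hy : y ≠ fun _ => none := by
        rintro rfl
        refine hx (funext fun j => ?_)
        by_contra hj
        obtain ⟨s, hs⟩ := Option.ne_none_iff_exists'.1 hj
        simpa using hxy j s hs
      intro heq
      by_cases h : ∃ k, IsExhausted c x k
      · obtain ⟨k, hk, hkx⟩ := lam_pos x h
        by_cases h' : ∃ k, IsExhausted c y k
        · obtain ⟨k', hk', hky⟩ := lam_pos y h'
          rw [hkx, hky, Prod.mk.injEq] at heq
          obtain rfl : k' = k := Fin.ext (by have := heq.1; dsimp only at this; omega)
          have := heq.2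
          rw [majoritySign_eq (hr _) hk hxy] at this
          simp at this
        · have := hlt y hy h'
          rw [hkx, lam_neg y h', Prod.mk.injEq] at heq
          have := heq.1
          dsimp only at this
          omega
      · have hlx := hlt x hx h
        by_cases h' : ∃ k, IsExhausted c y k
        · obtain ⟨k', hk', hky⟩ := lam_pos y h'
          rw [lam_neg x h, hky, Prod.mk.injEq] at heq
          have := heq.1
          dsimp only at this
          omega
        -- If `y` extends `x` but starts with the opposite sign, prefixing that sign to an
        -- alternating sequence of `x` shows that `y` alternates strictly longer.
        · rw [lam_neg x h, lam_neg y h', Prod.mk.injEq] at heq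
          have h1 := heq.1
          have h2 : firstSign y = !firstSign x := heq.2
          have h3 := altLen_mono hxy (!firstSign x)
          have h4 := altLen_not_firstSign hx
          have h5 := altLen_not_firstSign hy
          dsimp only at h1
          rw [← h2] at h3 h4 h1
          omega
  have := this.le
  omega

theorem exists_fair_signs (hc : Function.Surjective c) :
    ∃ x : Fin n → Option Bool,
      (∀ i j : Fin n, (i : ℕ) + 1 = j → ∀ s, x i = some s → x j ≠ some s) ∧
      ∀ k, entryCount c x k none = 1 ∧
        entryCount c x k (some true) ≤ entryCount c x k (some false) + 1 ∧
        entryCount c x k (some false) ≤ entryCount c x k (some true) + 1 := by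
  obtain ⟨x, hx, hlen⟩ := exists_alternating_fair hc
  have hpos : ∀ k, 1 ≤ entryCount c x k none := fun k =>
    Nat.one_le_iff_ne_zero.2 fun h => hx k (Or.inr (Or.inr h))
  have hsum : ∑ k, entryCount c x k none = ∑ i, if x i = none then 1 else 0 := by
    rw [← Finset.card_filter, Finset.card_eq_sum_card_fiberwise (f := c) (t := Finset.univ)
      (fun _ _ => by simp)]
    simp only [entryCount, Finset.filter_filter, and_comm]
  have htot : (∑ i, if x i = none then 1 else 0) + (∑ i, if x i = none then 0 else 1) = n := by
    rw [← Finset.sum_add_distrib]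
    calc _ = ∑ i : Fin n, 1 := Finset.sum_congr rfl fun i _ => by split_ifs <;> rfl
      _ = n := by simp
  have hm : ∑ k : Fin m, 1 ≤ ∑ k, entryCount c x k none := Finset.sum_le_sum fun k _ => hpos k
  have hm' : ∑ k : Fin m, 1 = m := by simp
  have hle := altLen_le_sum x (!firstSign x)
  refine ⟨x, fun i j hij s hi hj => ?_, fun k => ?_⟩
  · have := altLen_lt_sum hij hi hj (!firstSign x)
    omega
  · have h1 : entryCount c x k none = 1 := by
      -- There are at least m unsigned positions, one per colour, and at most m by the alternation
      -- bound, so each colour has exactly one.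
      refine (((Finset.sum_eq_sum_iff_of_le fun k _ => hpos k).1 ?_) k (Finset.mem_univ k)).symm
      omega
    have := hx k
    simp only [IsExhausted, h1] at this
    omega

end colouring

/-! ### Transfer to the path -/

theorem mainTheorem4 {V κ : Type*} (G : SimpleGraph V) (n : ℕ)
    (hG : Nonempty (G ≃g SimpleGraph.pathGraph n)) (c : V → κ) :
    ∃ D A B : Set V,
      (∀ k ∈ Set.range c, ∃! v, v ∈ D ∧ c v = k) ∧
      A ∪ B = Dᶜ ∧ Disjoint A B ∧
      G.IsIndepSet A ∧ G.IsIndepSet B ∧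
      ∀ k : κ,
        -1 ≤ ((A ∩ c ⁻¹' {k}).ncard : ℤ) - ((B ∩ c ⁻¹' {k}).ncard : ℤ) ∧
        ((A ∩ c ⁻¹' {k}).ncard : ℤ) - ((B ∩ c ⁻¹' {k}).ncard : ℤ) ≤ 1 := by
  obtain ⟨e⟩ := hG
  have : Finite V := Finite.of_equiv _ e.toEquiv.symm
  obtain ⟨m, ⟨g⟩⟩ := Finite.exists_equiv_fin (Set.range c)
  let c' : Fin n → Fin m := fun i => g ⟨c (e.symm i), Set.mem_range_self _⟩
  have hc'_iff : ∀ (v : V) (k : Set.range c), c' (e v) = g k ↔ c v = k := fun v k => by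
    simp [c', Subtype.ext_iff]
  have hc' : Function.Surjective c' := fun j => by
    obtain ⟨⟨_, v, rfl⟩, rfl⟩ := g.surjective j
    exact ⟨e v, (hc'_iff v _).2 rfl⟩
  obtain ⟨x, halt, hfair⟩ := exists_fair_signs hc'
  have hcount : ∀ (k : Set.range c) (o : Option Bool),
      ({v | x (e v) = o} ∩ c ⁻¹' {(k : κ)}).ncard = entryCount c' x (g k) o := by
    intro k o
    rw [entryCount, ← Set.ncard_coe_finset]
    refine Set.ncard_congr (fun v _ => e v) ?_ ?_ ?_
    · rintro v ⟨h1, h2⟩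
      simpa using ⟨(hc'_iff v k).2 h2, h1⟩
    · intro v w _ _ h
      exact e.injective h
    · intro i hi
      obtain ⟨v, rfl⟩ := e.surjective i
      simp only [Finset.coe_filter, Finset.mem_univ, true_and, Set.mem_ofPred_eq] at hi
      exact ⟨v, ⟨hi.2, (hc'_iff v k).1 hi.1⟩, rfl⟩
  have hindep : ∀ s : Bool, G.IsIndepSet {v | x (e v) = some s} := by
    intro s v hv w hw _ hadj
    rw [← e.map_adj_iff, SimpleGraph.pathGraph_adj] at hadj
    rcases hadj with h | h
    · exact halt _ _ h s hv hw
    · exact halt _ _ h s hw hv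
  refine ⟨{v | x (e v) = none}, {v | x (e v) = some true}, {v | x (e v) = some false},
    fun k hk => ?_, ?_, ?_, hindep true, hindep false, fun k => ?_⟩
  · have h := hcount ⟨k, hk⟩ none
    rw [(hfair _).1, Set.ncard_eq_one] at h
    obtain ⟨v, hv⟩ := h
    have hmem : ∀ w, (w ∈ {v | x (e v) = none} ∧ c w = k) ↔ w = v := fun w => by
      have := Set.ext_iff.1 hv w
      simpa using this
    exact ⟨v, (hmem v).2 rfl, fun w hw => (hmem w).1 hw⟩
  · ext v
    rcases h : x (e v) with _ | _ | _ <;> simp [h]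
  · rw [Set.disjoint_left]
    intro v h1 h2
    simp only [Set.mem_ofPred_eq] at h1 h2
    simp [h1] at h2
  · by_cases hk : k ∈ Set.range c
    · have h1 := hcount ⟨k, hk⟩ (some true)
      have h2 := hcount ⟨k, hk⟩ (some false)
      have h3 := hfair (g ⟨k, hk⟩)
      dsimp only at h1 h2
      rw [h1, h2]
      omega
    · have : c ⁻¹' {k} = ∅ := Set.preimage_singleton_eq_empty.2 hk
      simp [this]
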